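/- Let $\mathcal P(X)$ and $\mathcal P_c(X)$ be the Borel probability measures on $X$ and those with compact support, $W_1$ the 1-Wasserstein distance, and $T\mathbb R^d=\mathbb R^d\times\mathbb R^d\ni(x,v)$. Let $V:\mathcal P(\mathbb R^d)\to\mathcal P(T\mathbb R^d)$ be a probability vector field, i.e. the first marginal of $V[\mu]$ is $\mu$ for every $\mu$, such that (H1) there is $C>0$ with $\sup_{(x,v)\in\operatorname{supp}V[\mu]}|v|\le C\,(1+\sup_{x\in\operatorname{supp}\mu}|x|)$ for all $\mu\in\mathcal P_c(\mathbb R^d)$; (H2) $V$ maps $\mathcal P_c(\mathbb R^d)$ into $\mathcal P_c(T\mathbb R^d)$ and is continuous there for $W_1$. Let $T>0$ and $\mu_0\in\mathcal P_c(\mathbb R^d)$. For an integer $N\ge1$ put $\Delta_N=T/N$, $x_i=\frac{T}{N^2}i$ and $v_j=\frac1N j$ for $i,j\in\mathbb Z^d$, $Q=[0,\frac T{N^2})^d$, $Q'=[0,\frac1N)^d$, $m^x_i(\mu)=\mu(x_i+Q)$ and $m^v_{ij}(W)=W(\{x_i\}\times(v_j+Q'))$. The Lattice Approximate Solution (LAS)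 $(\mu^N_t)_{t\in[0,T]}$ is defined by $\mu^N_0=\sum_i m^x_i(\mu_0)\,\delta_{x_i}$ and, recursively in $k$, $$\mu^N_{k\Delta_N+s}=\sum_{i,j}m^v_{ij}\big(V[\mu^N_{k\Delta_N}]\big)\,\delta_{x_i+s v_j},\qquad 0\le s\le\Delta_N .$$ For an interval $I$ let $\Gamma_I=C(I;\mathbb R^d)$ with uniform convergence, and $e_t(\gamma)=\gamma(t)$. Put $I_a^b=[a\Delta_N,b\Delta_N]$. Let $$\eta^N_{I_\ell^{\ell+1}}=\sum_{i,j}m^v_{ij}\big(V[\mu^N_{\ell\Delta_N}]\big)\,\delta_{\gamma^\ell_{ij}}\in\mathcal P(\Gamma_{I_\ell^{\ell+1}}),\qquad \gamma^\ell_{ij}(t)=x_i+(t-\ell\Delta_N)v_j ,$$ and, for $h=1,\dots,N-1$, $$\eta^N_{I_0^{h+1}}=\int_{\mathbb R^d} M\sharp\big(\eta^N_{I_0^h,x}\otimes\eta^N_{I_h^{h+1},x}\big)\,d\mu^N_{h\Delta_N}(x),$$ where $\eta^N_{I_0^h,x}$ and $\eta^N_{I_h^{h+1},x}$ are the disintegrations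 of $\eta^N_{I_0^h}$ and $\eta^N_{I_h^{h+1}}$ with respect to $e_{h\Delta_N}$, and $M$ is the merge map, which sends a pair of curves on $I_0^h$ and $I_h^{h+1}$ that agree at $h\Delta_N$ to their concatenation. Let $\eta^N=\eta^N_{I_0^N}\in\mathcal P(\Gamma_{[0,T]})$. Then: (0) The lattice points that carry mass are bounded uniformly in $N$: there is $R$ such that, for all $N\ge1$, $0\le k\le N$ and $i,j$, $m^v_{ij}(V[\mu^N_{k\Delta_N}])\ne0$ implies $|x_i|\le R$ and $|v_j|\le R$. (So, for $N$ large, restricting the lattices to the boxes $[-TN,TN]^d$ and $[-N,N]^d$ changes nothing.) (1) For every $N\ge1$, $\eta^N$ is a probabilistic representation of the LAS: $e_t\sharp\eta^N=\mu^N_t$ for all $t\in[0,T]$. (2) Let $N_1<N_2<\cdots$ and $\mu_t\in\mathcal P(\mathbb R^d)$, $t\in[0,T]$, be such that $\sup_{t\in[0,T]}W_1(\mu^{N_n}_t,\mu_t)\to0$ as $n\to\infty$. Then a subsequence of $(\eta^{N_n})_n$ converges weakly (against bounded continuous functions on $\Gamma_{[0,T]}$) to some $\eta\in\mathcal P(\Gamma_{[0,T]})$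 with $e_t\sharp\eta=\mu_t$ for all $t\in[0,T]$. -/

import Mathlib

open MeasureTheory ProbabilityTheory Filter Topology
open scoped ENNReal

namespace MDE

noncomputable section

/-- The space `ℝ^d` with its Euclidean norm. The tangent bundle `Tℝ^d` is `E d × E d`, with
points `(x, v)`: position `x`, velocity `v`. -/
abbrev E (d : ℕ) : Type := EuclideanSpace ℝ (Fin d)

/-! ### Compactly supported measures, Wasserstein distance -/

/-- `μ` belongs to `𝒫_c(X)`: it has compact support. -/
def HasCompactSupp {X : Type*} [TopologicalSpace X] [MeasurableSpace X]
    (μ : ProbabilityMeasure X) : Prop :=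
  IsCompact (μ : Measure X).support

/-- The 1-Wasserstein distance, with values in `[0, ∞]`: the infimum of the transport cost
`∫ dist(x, y) dπ(x, y)` over all couplings `π` of `μ` and `ν`. -/
def W1 {X : Type*} [PseudoEMetricSpace X] [MeasurableSpace X] (μ ν : ProbabilityMeasure X) :
    ℝ≥0∞ :=
  ⨅ π : {π : Measure (X × X) //
      π.map Prod.fst = (μ : Measure X) ∧ π.map Prod.snd = (ν : Measure X)},
    ∫⁻ z, edist z.1 z.2 ∂π.1

/-! ### Probability vector fields -/

/-- A probability vector field: a map `V : 𝒫(ℝ^d) → 𝒫(Tℝ^d)` such that the first marginal of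
`V[μ]` is `μ`. -/
structure PVF (d : ℕ) where
  /-- the map `μ ↦ V[μ]` -/
  toFun : ProbabilityMeasure (E d) → ProbabilityMeasure (E d × E d)
  fst_eq : ∀ μ, (toFun μ : Measure (E d × E d)).map Prod.fst = (μ : Measure (E d))

/-- (H1), sublinearity: for some `C > 0` and all `μ ∈ 𝒫_c(ℝ^d)`,
`sup_{(x,v) ∈ supp V[μ]} |v| ≤ C (1 + sup_{x ∈ supp μ} |x|)`. -/
def PVF.Sublinear {d : ℕ} (V : PVF d) : Prop :=
  ∃ C : ℝ, 0 < C ∧ ∀ μ : ProbabilityMeasure (E d), HasCompactSupp μ →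
    ∀ p ∈ (V.toFun μ : Measure (E d × E d)).support,
      ‖p.2‖ ≤ C * (1 + sSup ((fun x : E d => ‖x‖) '' (μ : Measure (E d)).support))

/-- (H2): `V` maps `𝒫_c(ℝ^d)` into `𝒫_c(Tℝ^d)` and is continuous there, both spaces carrying the
1-Wasserstein distance. -/
def PVF.ContinuousOnCompact {d : ℕ} (V : PVF d) : Prop :=
  (∀ μ, HasCompactSupp μ → HasCompactSupp (V.toFun μ)) ∧
  ∀ μ, HasCompactSupp μ → ∀ ε : ℝ≥0∞, 0 < ε → ∃ δ : ℝ≥0∞, 0 < δ ∧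
    ∀ ν, HasCompactSupp ν → W1 μ ν < δ → W1 (V.toFun μ) (V.toFun ν) < ε

/-! ### The lattice and the discretization operators -/

/-- Time step `Δ_N = T / N`. -/
def tStep (T : ℝ) (N : ℕ+) : ℝ := T / (N : ℕ)

/-- Velocity step `Δ_N^v = 1 / N`. -/
def vStep (N : ℕ+) : ℝ := 1 / (N : ℕ)

/-- Space step `Δ_N^x = Δ_N^v Δ_N = T / N²`. -/
def xStep (T : ℝ) (N : ℕ+) : ℝ := vStep N * tStep T N

/-- The point with multi-index `i ∈ ℤ^d` of the lattice `s ℤ^d`. -/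
def latticePoint {d : ℕ} (s : ℝ) (i : Fin d → ℤ) : E d := WithLp.toLp 2 fun a => s * (i a : ℝ)

/-- The half-open cube `p + [0, s)^d`. -/
def cell {d : ℕ} (s : ℝ) (p : E d) : Set (E d) := {y | ∀ a, y a - p a ∈ Set.Ico 0 s}

/-- The weight `m_i^x(μ) = μ(x_i + Q)`. -/
def massX {d : ℕ} (T : ℝ) (N : ℕ+) (μ : Measure (E d)) (i : Fin d → ℤ) : ℝ≥0∞ :=
  μ (cell (xStep T N) (latticePoint (xStep T N) i))

/-- The weight `m_{ij}^v(W) = W({(x_i, v) : v ∈ v_j + Q'})`. -/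
def massV {d : ℕ} (T : ℝ) (N : ℕ+) (W : Measure (E d × E d)) (i j : Fin d → ℤ) : ℝ≥0∞ :=
  W ({latticePoint (xStep T N) i} ×ˢ cell (vStep N) (latticePoint (vStep N) j))

/-- The discretization `𝒜_N^x(μ) = ∑_i m_i^x(μ) δ_{x_i}`. -/
def discX {d : ℕ} (T : ℝ) (N : ℕ+) (μ : Measure (E d)) : Measure (E d) :=
  Measure.sum fun i : Fin d → ℤ => massX T N μ i • Measure.dirac (latticePoint (xStep T N) i)

/-- The measure `∑_{i,j} m_{ij}^v(W) δ_{f(x_i, v_j)}`. With `f` the identity this is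
`𝒜_N^v(W)`. -/
def discV {d : ℕ} {β : Type*} [MeasurableSpace β] (T : ℝ) (N : ℕ+) (W : Measure (E d × E d))
    (f : E d → E d → β) : Measure β :=
  Measure.sum fun ij : (Fin d → ℤ) × (Fin d → ℤ) =>
    massV T N W ij.1 ij.2 •
      Measure.dirac (f (latticePoint (xStep T N) ij.1) (latticePoint (vStep N) ij.2))

lemma tStep_pos {T : ℝ} (hT : 0 < T) (N : ℕ+) : 0 < tStep T N :=
  div_pos hT (by exact_mod_cast N.pos)

lemma vStep_pos (N : ℕ+) : 0 < vStep N :=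
  div_pos one_pos (by exact_mod_cast N.pos)

lemma xStep_pos {T : ℝ} (hT : 0 < T) (N : ℕ+) : 0 < xStep T N :=
  mul_pos (vStep_pos N) (tStep_pos hT N)

lemma measurableSet_cell {d : ℕ} (s : ℝ) (p : E d) : MeasurableSet (cell s p) := by
  have : cell s p = ⋂ a, (fun y : E d => y a - p a) ⁻¹' Set.Ico 0 s := by
    ext y; simp [cell]
  rw [this]
  refine MeasurableSet.iInter fun a => ?_
  have h : Continuous fun y : E d => y a - p a := by fun_prop
  exact h.measurable measurableSet_Ico

lemma mem_cell_iff {d : ℕ} {s : ℝ} (hs : 0 < s) (i : Fin d → ℤ) (y : E d) :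
    y ∈ cell s (latticePoint s i) ↔ ∀ a, ⌊y a / s⌋ = i a := by
  simp only [cell, latticePoint, Set.mem_ofPred_eq, Set.mem_Ico]
  refine forall_congr' fun a => ?_
  rw [Int.floor_eq_iff, le_div_iff₀ hs, div_lt_iff₀ hs]
  constructor <;> rintro ⟨h1, h2⟩ <;> constructor <;> nlinarith

lemma iUnion_cell {d : ℕ} {s : ℝ} (hs : 0 < s) :
    ⋃ i : Fin d → ℤ, cell s (latticePoint s i) = Set.univ := by
  ext y
  simp only [Set.mem_iUnion, Set.mem_univ, iff_true]
  exact ⟨fun a => ⌊y a / s⌋, (mem_cell_iff hs _ y).2 fun a => rfl⟩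

lemma disjoint_cell {d : ℕ} {s : ℝ} (hs : 0 < s) {i j : Fin d → ℤ} (hij : i ≠ j) :
    Disjoint (cell s (latticePoint s i)) (cell s (latticePoint s j)) := by
  rw [Set.disjoint_left]
  intro y hi hj
  rw [mem_cell_iff hs] at hi hj
  exact hij (funext fun a => (hi a).symm.trans (hj a))

lemma latticePoint_injective {d : ℕ} {s : ℝ} (hs : 0 < s) :
    Function.Injective (latticePoint s : (Fin d → ℤ) → E d) := by
  intro i j h
  funext a
  have := congrArg (fun y : E d => y a) h
  simpa [latticePoint, hs.ne'] using this

lemma measurableSet_range_latticePoint {d : ℕ} (s : ℝ) :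
    MeasurableSet (Set.range (latticePoint s : (Fin d → ℤ) → E d)) :=
  (Set.countable_range _).measurableSet

lemma discX_isProbabilityMeasure {d : ℕ} {T : ℝ} (hT : 0 < T) (N : ℕ+) (μ : Measure (E d))
    [IsProbabilityMeasure μ] : IsProbabilityMeasure (discX T N μ) := by
  constructor
  rw [discX, Measure.sum_apply _ MeasurableSet.univ]
  simp only [Measure.smul_apply, measure_univ, smul_eq_mul, mul_one, massX]
  rw [← measure_iUnion (fun i j hij => disjoint_cell (xStep_pos hT N) hij)
    (fun i => measurableSet_cell _ _), iUnion_cell (xStep_pos hT N), measure_univ]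

lemma discX_compl_lattice {d : ℕ} (T : ℝ) (N : ℕ+) (μ : Measure (E d)) :
    discX T N μ (Set.range (latticePoint (xStep T N) : (Fin d → ℤ) → E d))ᶜ = 0 := by
  rw [discX, Measure.sum_apply _ (measurableSet_range_latticePoint _).compl]
  simp [(measurableSet_range_latticePoint (d := d) (xStep T N)).compl]

lemma discV_isProbabilityMeasure {d : ℕ} {β : Type*} [MeasurableSpace β] {T : ℝ} (hT : 0 < T)
    (N : ℕ+) (W : Measure (E d × E d)) [IsProbabilityMeasure W]
    (hW : W.map Prod.fst (Set.range (latticePoint (xStep T N) : (Fin d → ℤ) → E d))ᶜ = 0)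
    (f : E d → E d → β) : IsProbabilityMeasure (discV T N W f) := by
  constructor
  rw [discV, Measure.sum_apply _ MeasurableSet.univ]
  simp only [Measure.smul_apply, measure_univ, smul_eq_mul, mul_one, massV]
  rw [← measure_iUnion]
  · rw [Measure.map_apply measurable_fst (measurableSet_range_latticePoint _).compl] at hW
    have hU : (⋃ ij : (Fin d → ℤ) × (Fin d → ℤ),
        ({latticePoint (xStep T N) ij.1} : Set (E d)) ×ˢ
          cell (vStep N) (latticePoint (vStep N) ij.2)) =
        (Prod.fst ⁻¹' (Set.range (latticePoint (xStep T N) : (Fin d → ℤ) → E d))ᶜ)ᶜ := by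
      ext ⟨x, v⟩
      simp only [Set.mem_iUnion, Set.mem_prod, Set.mem_singleton_iff, Prod.exists,
        Set.preimage_compl, compl_compl, Set.mem_preimage, Set.mem_range]
      constructor
      · rintro ⟨i, j, rfl, -⟩
        exact ⟨i, rfl⟩
      · rintro ⟨i, rfl⟩
        have : v ∈ ⋃ j : Fin d → ℤ, cell (vStep N) (latticePoint (vStep N) j) := by
          rw [iUnion_cell (vStep_pos N)]; trivial
        obtain ⟨j, hj⟩ := Set.mem_iUnion.1 this
        exact ⟨i, j, rfl, hj⟩
    rw [hU, prob_compl_eq_one_iff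
      (measurable_fst (measurableSet_range_latticePoint _).compl)]
    exact hW
  · rintro ⟨i, j⟩ ⟨i', j'⟩ hne
    rw [Function.onFun, Set.disjoint_left]
    rintro ⟨x, v⟩ ⟨h1, h2⟩ ⟨h3, h4⟩
    simp only [Set.mem_singleton_iff] at h1 h2 h3 h4
    have hi : i = i' := latticePoint_injective (xStep_pos hT N) (h1.symm.trans h3)
    have hj : j = j' := by
      by_contra hj
      exact Set.disjoint_left.1 (disjoint_cell (vStep_pos N) hj) h2 h4
    exact hne (by rw [hi, hj])
  · exact fun ij => (measurableSet_singleton _).prod (measurableSet_cell _ _)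

lemma discV_step_compl_lattice {d : ℕ} (T : ℝ) (N : ℕ+) (W : Measure (E d × E d)) :
    discV T N W (fun x v => x + tStep T N • v)
      (Set.range (latticePoint (xStep T N) : (Fin d → ℤ) → E d))ᶜ = 0 := by
  rw [discV, Measure.sum_apply _ (measurableSet_range_latticePoint _).compl]
  simp only [ENNReal.tsum_eq_zero, Measure.smul_apply, smul_eq_mul, mul_eq_zero]
  intro ij
  right
  rw [Measure.dirac_apply' _ (measurableSet_range_latticePoint _).compl,
    Set.indicator_of_notMem]
  simp only [Set.mem_compl_iff, not_not]
  refine ⟨ij.1 + ij.2, ?_⟩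
  ext a
  simp [latticePoint, xStep]
  ring

/-! ### Lattice Approximate Solutions -/

/-- Probability measures carried by the space lattice `(T / N²) ℤ^d`. -/
abbrev GridProb (d : ℕ) (T : ℝ) (N : ℕ+) : Type :=
  {μ : ProbabilityMeasure (E d) //
    (μ : Measure (E d)) (Set.range (latticePoint (xStep T N) : (Fin d → ℤ) → E d))ᶜ = 0}

lemma PVF.fst_compl_lattice {d : ℕ} (V : PVF d) {T : ℝ} {N : ℕ+} (μ : GridProb d T N) :
    (V.toFun μ.1 : Measure (E d × E d)).map Prod.fst
      (Set.range (latticePoint (xStep T N) : (Fin d → ℤ) → E d))ᶜ = 0 := by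
  rw [V.fst_eq]; exact μ.2

/-- For a grid measure `μ`, the probability measure `∑_{i,j} m_{ij}^v(V[μ]) δ_{f(x_i, v_j)}`. -/
def PVF.disc {d : ℕ} (V : PVF d) {β : Type*} [MeasurableSpace β] {T : ℝ} (hT : 0 < T) {N : ℕ+}
    (μ : GridProb d T N) (f : E d → E d → β) : ProbabilityMeasure β :=
  ⟨discV T N (V.toFun μ.1 : Measure (E d × E d)) f,
    discV_isProbabilityMeasure hT N _ (V.fst_compl_lattice μ) f⟩

/-- The LAS at the node `k Δ_N`: `μ_0^N = 𝒜_N^x(μ_0)` and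
`μ_{k+1}^N = ∑_{i,j} m_{ij}^v(V[μ_k^N]) δ_{x_i + Δ_N v_j}`. -/
def lasNode {d : ℕ} (V : PVF d) (μ₀ : ProbabilityMeasure (E d)) {T : ℝ} (hT : 0 < T) (N : ℕ+) :
    ℕ → GridProb d T N
  | 0 => ⟨⟨discX T N (μ₀ : Measure (E d)), discX_isProbabilityMeasure hT N _⟩,
      discX_compl_lattice T N _⟩
  | k + 1 => ⟨V.disc hT (lasNode V μ₀ hT N k) (fun x v => x + tStep T N • v),
      discV_step_compl_lattice T N _⟩

/-- The LAS at time `t`: with `k = ⌊t / Δ_N⌋`, it is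
`∑_{i,j} m_{ij}^v(V[μ_k^N]) δ_{x_i + (t - k Δ_N) v_j}`. -/
def las {d : ℕ} (V : PVF d) (μ₀ : ProbabilityMeasure (E d)) {T : ℝ} (hT : 0 < T) (N : ℕ+)
    (t : ℝ) : ProbabilityMeasure (E d) :=
  V.disc hT (lasNode V μ₀ hT N ⌊t / tStep T N⌋₊)
    (fun x v => x + (t - (⌊t / tStep T N⌋₊ : ℝ) * tStep T N) • v)

/-! ### Spaces of continuous curves -/

/-- `Γ_{[a,b]} = C([a,b]; ℝ^d)` with the topology of uniform convergence. -/
abbrev Curves (d : ℕ) (a b : ℝ) : Type := C(Set.Icc a b, E d)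

instance instMeasurableSpaceCurves (d : ℕ) (a b : ℝ) : MeasurableSpace (Curves d a b) :=
  borel _

instance instBorelSpaceCurves (d : ℕ) (a b : ℝ) : BorelSpace (Curves d a b) := ⟨rfl⟩

/-- The evaluation map `e_t : γ ↦ γ(t)`. -/
def ev {d : ℕ} {a b : ℝ} (t : Set.Icc a b) (γ : Curves d a b) : E d := γ t

/-- The merge map `(γ₁, γ₂) ↦ γ₁ ⋆ γ₂`, from compatible pairs (those with `γ₁(b) = γ₂(b)`) to
curves on `[a,c]`. Incompatible pairs are sent to a constant curve. -/
def merge {d : ℕ} {a b c : ℝ} (hab : a ≤ b) (hbc : b ≤ c)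
    (p : Curves d a b × Curves d b c) : Curves d a c :=
  haveI : Fact (a ≤ b) := ⟨hab⟩
  haveI : Fact (b ≤ c) := ⟨hbc⟩
  ContinuousMap.concat p.1 p.2

lemma measurable_merge {d : ℕ} {a b c : ℝ} (hab : a ≤ b) (hbc : b ≤ c) :
    Measurable (merge (d := d) hab hbc) := by
  have : Fact (a ≤ b) := ⟨hab⟩
  have : Fact (b ≤ c) := ⟨hbc⟩
  have hD : IsClosed {p : Curves d a b × Curves d b c | p.1 ⊤ = p.2 ⊥} :=
    isClosed_eq (by fun_prop) (by fun_prop)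
  refine measurable_of_restrict_of_restrict_compl hD.measurableSet ?_ ?_
  · have h := (ContinuousMap.concatCM (a := a) (b := b) (c := c) (E := E d)).continuous
    exact h.measurable
  · have h : Continuous (fun p : ({p : Curves d a b × Curves d b c | p.1 ⊤ = p.2 ⊥}ᶜ :
        Set (Curves d a b × Curves d b c)) =>
          (ContinuousMap.const (Set.Icc a c) (p.1.1 ⊥) : Curves d a c)) := by
      refine ContinuousMap.continuous_of_continuous_uncurry _ ?_
      simp only [Function.uncurry_def, ContinuousMap.const_apply]
      fun_prop
    convert h.measurable using 1
    funext p
    have hp : ¬ (p.1.1 ⊤ = p.1.2 ⊥) := p.2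
    simp [Set.domRestrict, merge, ContinuousMap.concat, hp]

/-! ### The measures `η^N` on curves -/

/-- The node `k Δ_N`. -/
def node (T : ℝ) (N : ℕ+) (k : ℕ) : ℝ := (k : ℝ) * tStep T N

lemma node_mono {T : ℝ} (hT : 0 < T) (N : ℕ+) {k l : ℕ} (h : k ≤ l) :
    node T N k ≤ node T N l :=
  mul_le_mul_of_nonneg_right (by exact_mod_cast h) (tStep_pos hT N).le

lemma node_zero (T : ℝ) (N : ℕ+) : node T N 0 = 0 := by simp [node]

lemma node_last (T : ℝ) (N : ℕ+) : node T N (N.natPred + 1) = T := by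
  have h : ((N : ℕ) : ℝ) ≠ 0 := by exact_mod_cast N.ne_zero
  rw [PNat.natPred_add_one, node, tStep]
  field_simp

/-- The LAS characteristic `γ(t) = x + (t - a) v` on `[a,b]`. -/
def charCurve {d : ℕ} (a b : ℝ) (x v : E d) : Curves d a b :=
  ⟨fun t => x + ((t : ℝ) - a) • v, by fun_prop⟩

/-- The measure `∑_{i,j} m_{ij}^v(V[μ_ℓ^N]) δ_{γ_{i,j}^ℓ}` on curves over
`[ℓ Δ_N, (ℓ+1) Δ_N]`. -/
def etaStep {d : ℕ} (V : PVF d) (μ₀ : ProbabilityMeasure (E d)) {T : ℝ} (hT : 0 < T) (N : ℕ+)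
    (l : ℕ) : ProbabilityMeasure (Curves d (node T N l) (node T N (l + 1))) :=
  V.disc hT (lasNode V μ₀ hT N l) (charCurve (node T N l) (node T N (l + 1)))

/-- The disintegration `x ↦ η_x` of a probability measure `η` on curves with respect to `e_t`. -/
def disint {d : ℕ} {a b : ℝ} (t : Set.Icc a b) (η : ProbabilityMeasure (Curves d a b)) :
    Kernel (E d) (Curves d a b) :=
  condDistrib id (ev t) (η : Measure (Curves d a b))

instance instIsMarkovKernelDisint {d : ℕ} {a b : ℝ} (t : Set.Icc a b)
    (η : ProbabilityMeasure (Curves d a b)) : IsMarkovKernel (disint t η) := by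
  unfold disint; infer_instance

/-- The gluing `∫ M♯(η_x ⊗ η'_x) dμ(x)`, where `η_x` and `η'_x` are the disintegrations of `η`
and `η'` with respect to the evaluation at the common endpoint `b`, and `M` is the merge map. -/
def glue {d : ℕ} {a b c : ℝ} (hab : a ≤ b) (hbc : b ≤ c) (μ : ProbabilityMeasure (E d))
    (η : ProbabilityMeasure (Curves d a b)) (η' : ProbabilityMeasure (Curves d b c)) :
    ProbabilityMeasure (Curves d a c) :=
  ⟨(μ : Measure (E d)).bind
      (((disint ⟨b, Set.right_mem_Icc.2 hab⟩ η) ×ₖ (disint ⟨b, Set.left_mem_Icc.2 hbc⟩ η')).map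
        (merge hab hbc)), by
    have := Kernel.IsMarkovKernel.map
      ((disint ⟨b, Set.right_mem_Icc.2 hab⟩ η) ×ₖ (disint ⟨b, Set.left_mem_Icc.2 hbc⟩ η'))
      (measurable_merge (d := d) hab hbc)
    infer_instance⟩

/-- The measure on curves over `[0, (h+1) Δ_N]`: `etaStep` for `h = 0`, then by recursion the
gluing, over `μ_{h+1}^N`, of the measure on `[0, (h+1) Δ_N]` and of `etaStep` on
`[(h+1) Δ_N, (h+2) Δ_N]`. -/
def etaGlue {d : ℕ} (V : PVF d) (μ₀ : ProbabilityMeasure (E d)) {T : ℝ} (hT : 0 < T) (N : ℕ+) :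
    (h : ℕ) → ProbabilityMeasure (Curves d (node T N 0) (node T N (h + 1)))
  | 0 => etaStep V μ₀ hT N 0
  | h + 1 => glue (node_mono hT N (Nat.zero_le _)) (node_mono hT N (Nat.le_succ _))
      (lasNode V μ₀ hT N (h + 1)).1 (etaGlue V μ₀ hT N h) (etaStep V μ₀ hT N (h + 1))

/-- The identification of curves over `[a,b]` and over `[a',b']` when `a = a'` and `b = b'`. -/
def recast {d : ℕ} {a b a' b' : ℝ} (ha : a = a') (hb : b = b') (γ : Curves d a b) :
    Curves d a' b' :=
  γ.comp ⟨fun t => ⟨(t : ℝ), ha.trans_le t.2.1, t.2.2.trans_eq hb.symm⟩, by fun_prop⟩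

lemma measurable_recast {d : ℕ} {a b a' b' : ℝ} (ha : a = a') (hb : b = b') :
    Measurable (recast (d := d) ha hb) :=
  (ContinuousMap.continuous_precomp _).measurable

/-- The measure `η^N` on `Γ_{[0,T]}`, that is the glued measure on `[0, N Δ_N] = [0, T]`. -/
def eta {d : ℕ} (V : PVF d) (μ₀ : ProbabilityMeasure (E d)) {T : ℝ} (hT : 0 < T) (N : ℕ+) :
    ProbabilityMeasure (Curves d 0 T) :=
  (etaGlue V μ₀ hT N N.natPred).map
    (measurable_recast (node_zero T N) (node_last T N)).aemeasurable

/-- `η` is a probabilistic representation of the family `(μ_t)`: `e_t♯η = μ_t` for all `t`. -/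
def Represents {d : ℕ} {T : ℝ} (η : ProbabilityMeasure (Curves d 0 T))
    (μ : Set.Icc 0 T → ProbabilityMeasure (E d)) : Prop :=
  ∀ t : Set.Icc 0 T, (η : Measure (Curves d 0 T)).map (ev t) = (μ t : Measure (E d))

end

end MDE

open scoped NNReal

namespace MDE

variable {d : ℕ}

/-! ### Disintegration and gluing -/

/-! Gluing. Disintegrating along `ev t` gives kernels that are carried, for almost every `x`, by
curves through `x`. When both curve measures have the marginal `μ` at the common node, the mixture
over `μ` of the products of their kernels is therefore a coupling carried by compatible pairs, and
`glue` is its image under `merge` (`exists_coupling_glue`). Evaluation before the node sees only the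
first marginal of the coupling, evaluation after it only the second. The marginals do agree: since
the first marginal of `V[μ]` is `μ`, the LAS formulas of consecutive intervals coincide at the node
(`las_of_mem_Icc`). Induction on the number of glued intervals then gives the representation of the
LAS.

Bounds. Rounding a velocity to the lattice costs at most `√d`, so by (H1) the radius `r` of the
support becomes at most `r + Δ (C (1 + r) + √d)` after one step. Hence `1 + r` grows at most by the
factor `1 + Δ (C + √d)`, and at most by `exp (T (C + √d))` over `[0, T]`.

Compactness. All curves that carry mass are thus bounded and Lipschitz with constants independent of
`N`, and merging preserves both constants. By Arzelà–Ascoli the measures `η^N` live on one compact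
set, and Prokhorov's theorem yields a weak limit along a subsequence. Push-forward by `ev t` is
weakly continuous and `W1` convergence implies weak convergence, so the marginals of the limit are
the `μ_t`. -/

lemma continuous_ev {a b : ℝ} (t : Set.Icc a b) : Continuous (ev (d := d) t) :=
  by unfold ev; fun_prop

lemma disint_comp_map_ev {a b : ℝ} (t : Set.Icc a b) (η : ProbabilityMeasure (Curves d a b)) :
    disint t η ∘ₘ ((η : Measure (Curves d a b)).map (ev t)) = η := by
  rw [disint, condDistrib_comp_map (continuous_ev t).measurable.aemeasurable aemeasurable_id,
    Measure.map_id]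

/-- The joint law of `(ev t γ, γ)` is the composition-product of the marginal with the kernel, and
it is carried by the graph `{(x, γ) | ev t γ = x}`; slicing in `x` gives the claim. -/
lemma disint_ae_ev_eq {a b : ℝ} (t : Set.Icc a b) (η : ProbabilityMeasure (Curves d a b)) :
    ∀ᵐ x ∂((η : Measure (Curves d a b)).map (ev t)), ∀ᵐ γ ∂(disint t η x), ev t γ = x := by
  have hm : MeasurableSet {p : E d × Curves d a b | ev t p.2 = p.1} :=
    measurableSet_eq_fun ((continuous_ev t).measurable.comp measurable_snd) measurable_fst
  refine (Measure.ae_compProd_iff hm).1 ?_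
  rw [disint, compProd_map_condDistrib aemeasurable_id,
    ae_map_iff ((continuous_ev t).measurable.prodMk measurable_id).aemeasurable hm]
  exact .of_forall fun γ => rfl

/-- The glued measure is the image under the merge map of a coupling that is concentrated on the
compatible pairs. -/
lemma exists_coupling_glue {a b c : ℝ} (hab : a ≤ b) (hbc : b ≤ c) (μ : ProbabilityMeasure (E d))
    (η : ProbabilityMeasure (Curves d a b)) (η' : ProbabilityMeasure (Curves d b c))
    (hη : (η : Measure (Curves d a b)).map (ev ⟨b, Set.right_mem_Icc.2 hab⟩) = μ)
    (hη' : (η' : Measure (Curves d b c)).map (ev ⟨b, Set.left_mem_Icc.2 hbc⟩) = μ) :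
    ∃ π : Measure (Curves d a b × Curves d b c),
      π.map Prod.fst = η ∧ π.map Prod.snd = η' ∧
      (∀ᵐ p ∂π, p.1 ⟨b, Set.right_mem_Icc.2 hab⟩ = p.2 ⟨b, Set.left_mem_Icc.2 hbc⟩) ∧
      (glue hab hbc μ η η' : Measure (Curves d a c)) = π.map (merge hab hbc) := by
  set κ := disint ⟨b, Set.right_mem_Icc.2 hab⟩ η
  set κ' := disint ⟨b, Set.left_mem_Icc.2 hbc⟩ η'
  refine ⟨(κ ×ₖ κ') ∘ₘ (μ : Measure (E d)), ?_, ?_, ?_, ?_⟩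
  · rw [Measure.map_comp _ _ measurable_fst, ← Kernel.fst_eq, Kernel.fst_prod, ← hη]
    exact disint_comp_map_ev _ η
  · rw [Measure.map_comp _ _ measurable_snd, ← Kernel.snd_eq, Kernel.snd_prod, ← hη']
    exact disint_comp_map_ev _ η'
  · rw [Measure.ae_comp_iff]
    · have h := disint_ae_ev_eq ⟨b, Set.right_mem_Icc.2 hab⟩ η
      have h' := disint_ae_ev_eq ⟨b, Set.left_mem_Icc.2 hbc⟩ η'
      -- The two exceptional sets are null for the two marginals at `b`; since both marginals are
      -- `μ`, they can be discarded together.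
      rw [hη] at h
      rw [hη'] at h'
      filter_upwards [h, h'] with x hx hx'
      rw [Kernel.prod_apply]
      filter_upwards [Measure.quasiMeasurePreserving_fst.ae hx,
        Measure.quasiMeasurePreserving_snd.ae hx'] with p hp hp'
      exact hp.trans hp'.symm
    · exact measurableSet_eq_fun
        ((continuous_ev ⟨b, Set.right_mem_Icc.2 hab⟩).measurable.comp measurable_fst)
        ((continuous_ev ⟨b, Set.left_mem_Icc.2 hbc⟩).measurable.comp measurable_snd)
  · rw [Measure.map_comp _ _ (measurable_merge hab hbc)]
    rfl

lemma merge_apply_left {a b c : ℝ} (hab : a ≤ b) (hbc : b ≤ c)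
    {p : Curves d a b × Curves d b c}
    (hp : p.1 ⟨b, Set.right_mem_Icc.2 hab⟩ = p.2 ⟨b, Set.left_mem_Icc.2 hbc⟩)
    (t : Set.Icc a c) (ht : (t : ℝ) ≤ b) : merge hab hbc p t = p.1 ⟨t, t.2.1, ht⟩ := by
  have : Fact (a ≤ b) := ⟨hab⟩
  have : Fact (b ≤ c) := ⟨hbc⟩
  exact ContinuousMap.concat_left (f := p.1) (g := p.2) hp ht

lemma merge_apply_right {a b c : ℝ} (hab : a ≤ b) (hbc : b ≤ c)
    {p : Curves d a b × Curves d b c}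
    (hp : p.1 ⟨b, Set.right_mem_Icc.2 hab⟩ = p.2 ⟨b, Set.left_mem_Icc.2 hbc⟩)
    (t : Set.Icc a c) (ht : b ≤ (t : ℝ)) : merge hab hbc p t = p.2 ⟨t, ht, t.2.2⟩ := by
  have : Fact (a ≤ b) := ⟨hab⟩
  have : Fact (b ≤ c) := ⟨hbc⟩
  exact ContinuousMap.concat_right (f := p.1) (g := p.2) hp ht

/-- On compatible pairs the merged curve at a time `t ≤ b` is the value of the first curve, so only
the first marginal of the coupling matters. -/
lemma glue_map_ev_left {a b c : ℝ} (hab : a ≤ b) (hbc : b ≤ c) (μ : ProbabilityMeasure (E d))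
    (η : ProbabilityMeasure (Curves d a b)) (η' : ProbabilityMeasure (Curves d b c))
    (hη : (η : Measure (Curves d a b)).map (ev ⟨b, Set.right_mem_Icc.2 hab⟩) = μ)
    (hη' : (η' : Measure (Curves d b c)).map (ev ⟨b, Set.left_mem_Icc.2 hbc⟩) = μ)
    (t : Set.Icc a c) (ht : (t : ℝ) ≤ b) :
    (glue hab hbc μ η η' : Measure (Curves d a c)).map (ev t) =
      (η : Measure (Curves d a b)).map (ev ⟨t, t.2.1, ht⟩) := by
  obtain ⟨π, h1, -, hc, hg⟩ := exists_coupling_glue hab hbc μ η η' hη hη'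
  rw [hg, ← h1, Measure.map_map (continuous_ev _).measurable (measurable_merge hab hbc),
    Measure.map_map (continuous_ev _).measurable measurable_fst]
  refine Measure.map_congr ?_
  filter_upwards [hc] with p hp
  exact merge_apply_left hab hbc hp t ht

lemma glue_map_ev_right {a b c : ℝ} (hab : a ≤ b) (hbc : b ≤ c) (μ : ProbabilityMeasure (E d))
    (η : ProbabilityMeasure (Curves d a b)) (η' : ProbabilityMeasure (Curves d b c))
    (hη : (η : Measure (Curves d a b)).map (ev ⟨b, Set.right_mem_Icc.2 hab⟩) = μ)
    (hη' : (η' : Measure (Curves d b c)).map (ev ⟨b, Set.left_mem_Icc.2 hbc⟩) = μ)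
    (t : Set.Icc a c) (ht : b ≤ (t : ℝ)) :
    (glue hab hbc μ η η' : Measure (Curves d a c)).map (ev t) =
      (η' : Measure (Curves d b c)).map (ev ⟨t, ht, t.2.2⟩) := by
  obtain ⟨π, -, h2, hc, hg⟩ := exists_coupling_glue hab hbc μ η η' hη hη'
  rw [hg, ← h2, Measure.map_map (continuous_ev _).measurable (measurable_merge hab hbc),
    Measure.map_map (continuous_ev _).measurable measurable_snd]
  refine Measure.map_congr ?_
  filter_upwards [hc] with p hp
  exact merge_apply_right hab hbc hp t ht

/-! ### Bounded Lipschitz curves -/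

/-- The curves that are bounded by `r` and `L`-Lipschitz. -/
def lipCurves (d : ℕ) (a b r : ℝ) (L : ℝ≥0) : Set (Curves d a b) :=
  {γ | (∀ t, ‖γ t‖ ≤ r) ∧ LipschitzWith L γ}

/-- Both conditions survive pointwise limits. Closedness in the product topology serves
measurability as well as the Tychonoff argument for compactness. -/
lemma isClosed_setOf_lip (d : ℕ) (a b r : ℝ) (L : ℝ≥0) :
    IsClosed {f : Set.Icc a b → E d | (∀ t, ‖f t‖ ≤ r) ∧ LipschitzWith L f} := by
  have h : IsClosed ((⋂ t, {f : Set.Icc a b → E d | ‖f t‖ ≤ r}) ∩ {f | LipschitzWith L f}) :=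
    (isClosed_iInter fun t => isClosed_le (by fun_prop) continuous_const).inter
      (isClosed_setOfPred_lipschitzWith L)
  convert h using 1
  ext f
  simp

lemma measurableSet_lipCurves (a b r : ℝ) (L : ℝ≥0) :
    MeasurableSet (lipCurves d a b r L) :=
  ((isClosed_setOf_lip d a b r L).preimage
    (f := fun γ : Curves d a b => (γ : Set.Icc a b → E d))
    (continuous_pi fun t => continuous_ev t)).measurableSet

lemma isCompact_lipCurves (a b r : ℝ) (L : ℝ≥0) : IsCompact (lipCurves d a b r L) := by
  refine ArzelaAscoli.isCompact_of_equicontinuous _ ?_ ?_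
  · have himg : ContinuousMap.toFun '' lipCurves d a b r L =
        {f : Set.Icc a b → E d | (∀ t, ‖f t‖ ≤ r) ∧ LipschitzWith L f} := by
      ext f
      constructor
      · rintro ⟨γ, hγ, rfl⟩
        exact hγ
      · intro hf
        exact ⟨⟨f, hf.2.continuous⟩, hf, rfl⟩
    rw [himg]
    -- Pointwise compactness: a closed subset of a product of closed balls. Equicontinuity comes
    -- from the common Lipschitz constant.
    refine (isCompact_univ_pi fun _ : Set.Icc a b =>
      isCompact_closedBall (0 : E d) r).of_isClosed_subset (isClosed_setOf_lip d a b r L) ?_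
    intro f hf t _
    simpa using hf.1 t
  · exact (LipschitzWith.uniformEquicontinuous
      (fun γ : lipCurves d a b r L => ((γ : Curves d a b) : Set.Icc a b → E d)) L
      fun γ => γ.2.2).equicontinuous

/-- The constants do not deteriorate, so they survive any number of mergings. For times on either
side of `b`, the triangle inequality through the common value at `b` is enough, because the two
durations add up exactly. -/
lemma merge_mem_lipCurves {a b c r : ℝ} {L : ℝ≥0} (hab : a ≤ b) (hbc : b ≤ c)
    {p : Curves d a b × Curves d b c}
    (hp : p.1 ⟨b, Set.right_mem_Icc.2 hab⟩ = p.2 ⟨b, Set.left_mem_Icc.2 hbc⟩)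
    (h1 : p.1 ∈ lipCurves d a b r L) (h2 : p.2 ∈ lipCurves d b c r L) :
    merge hab hbc p ∈ lipCurves d a c r L := by
  constructor
  · intro t
    rcases le_total (t : ℝ) b with ht | ht
    · rw [merge_apply_left hab hbc hp t ht]
      exact h1.1 _
    · rw [merge_apply_right hab hbc hp t ht]
      exact h2.1 _
  · have key : ∀ s t : Set.Icc a c, (s : ℝ) ≤ t →
        dist (merge hab hbc p s) (merge hab hbc p t) ≤ L * (t - s) := by
      intro s t hst
      rcases le_total (t : ℝ) b with ht | ht
      · rw [merge_apply_left hab hbc hp t ht, merge_apply_left hab hbc hp s (hst.trans ht)]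
        refine (h1.2.dist_le_mul _ _).trans_eq ?_
        rw [Subtype.dist_eq, dist_comm, Real.dist_eq, abs_of_nonneg (sub_nonneg.2 hst)]
      · rcases le_total (s : ℝ) b with hs | hs
        · rw [merge_apply_left hab hbc hp s hs, merge_apply_right hab hbc hp t ht]
          have e1 := h1.2.dist_le_mul ⟨s, s.2.1, hs⟩ ⟨b, Set.right_mem_Icc.2 hab⟩
          have e2 := h2.2.dist_le_mul ⟨b, Set.left_mem_Icc.2 hbc⟩ ⟨t, ht, t.2.2⟩
          rw [Subtype.dist_eq, dist_comm (s : ℝ), Real.dist_eq,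
            abs_of_nonneg (sub_nonneg.2 hs)] at e1
          rw [Subtype.dist_eq, dist_comm b, Real.dist_eq,
            abs_of_nonneg (sub_nonneg.2 ht), ← hp] at e2
          refine (dist_triangle _ _ _).trans ((add_le_add e1 e2).trans_eq ?_)
          ring
        · rw [merge_apply_right hab hbc hp t ht, merge_apply_right hab hbc hp s hs]
          refine (h2.2.dist_le_mul _ _).trans_eq ?_
          rw [Subtype.dist_eq, dist_comm, Real.dist_eq, abs_of_nonneg (sub_nonneg.2 hst)]
    refine LipschitzWith.of_dist_le_mul fun s t => ?_
    rcases le_total (s : ℝ) t with hst | hst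
    · rw [dist_comm s, Subtype.dist_eq, Real.dist_eq, abs_of_nonneg (sub_nonneg.2 hst)]
      exact key s t hst
    · rw [dist_comm, Subtype.dist_eq, Real.dist_eq, abs_of_nonneg (sub_nonneg.2 hst)]
      exact key t s hst

lemma glue_ae_mem_lipCurves {a b c r : ℝ} {L : ℝ≥0} (hab : a ≤ b) (hbc : b ≤ c)
    (μ : ProbabilityMeasure (E d))
    (η : ProbabilityMeasure (Curves d a b)) (η' : ProbabilityMeasure (Curves d b c))
    (hη : (η : Measure (Curves d a b)).map (ev ⟨b, Set.right_mem_Icc.2 hab⟩) = μ)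
    (hη' : (η' : Measure (Curves d b c)).map (ev ⟨b, Set.left_mem_Icc.2 hbc⟩) = μ)
    (h : ∀ᵐ γ ∂(η : Measure (Curves d a b)), γ ∈ lipCurves d a b r L)
    (h' : ∀ᵐ γ ∂(η' : Measure (Curves d b c)), γ ∈ lipCurves d b c r L) :
    ∀ᵐ γ ∂(glue hab hbc μ η η' : Measure (Curves d a c)), γ ∈ lipCurves d a c r L := by
  obtain ⟨π, h1, h2, hc, hg⟩ := exists_coupling_glue hab hbc μ η η' hη hη'
  rw [← h1] at h
  rw [← h2] at h'
  rw [hg]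
  refine (ae_map_iff (measurable_merge hab hbc).aemeasurable
    (measurableSet_lipCurves a c r L)).2 ?_
  filter_upwards [hc, ae_of_ae_map measurable_fst.aemeasurable h,
    ae_of_ae_map measurable_snd.aemeasurable h'] with p hp hp1 hp2
  exact merge_mem_lipCurves hab hbc hp hp1 hp2

/-! ### The discretized measures and the LAS -/

lemma PVF.disc_map {β δ : Type*} [MeasurableSpace β] [MeasurableSpace δ] (V : PVF d) {T : ℝ}
    (hT : 0 < T) {N : ℕ+} (μ : GridProb d T N) (f : E d → E d → β) {g : β → δ}
    (hg : Measurable g) :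
    (V.disc hT μ f : Measure β).map g = V.disc hT μ fun x v => g (f x v) := by
  change (discV T N (V.toFun μ.1 : Measure (E d × E d)) f).map g =
    discV T N (V.toFun μ.1 : Measure (E d × E d)) fun x v => g (f x v)
  rw [discV, Measure.map_sum hg.aemeasurable, discV]
  simp_rw [Measure.map_smul, Measure.map_dirac' hg]

lemma PVF.disc_ae {β : Type*} [MeasurableSpace β] (V : PVF d) {T : ℝ}
    (hT : 0 < T) {N : ℕ+} (μ : GridProb d T N) (f : E d → E d → β) {s : Set β}
    (hs : MeasurableSet s)
    (h : ∀ i j, massV T N (V.toFun μ.1 : Measure (E d × E d)) i j ≠ 0 →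
      f (latticePoint (xStep T N) i) (latticePoint (vStep N) j) ∈ s) :
    ∀ᵐ b ∂(V.disc hT μ f : Measure β), b ∈ s := by
  change ∀ᵐ b ∂discV T N (V.toFun μ.1 : Measure (E d × E d)) f, b ∈ s
  refine (Measure.ae_sum_iff' hs).2 ?_
  rintro ⟨i, j⟩
  by_cases h0 : massV T N (V.toFun μ.1 : Measure (E d × E d)) i j = 0
  · simp only [h0, zero_smul, ae_zero]
    exact eventually_bot
  · exact Measure.ae_smul_measure ((ae_dirac_iff hs).2 (h i j h0)) _

/-- The sets `{x_i} × (v_j + Q')` are disjoint and carry all of `V[μ]`, because its first marginal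
lives on the grid; on each of them the position is constant. This makes the LAS formula at elapsed
time zero return the measure at the node. -/
lemma PVF.disc_fst (V : PVF d) {T : ℝ} (hT : 0 < T) {N : ℕ+} (μ : GridProb d T N) :
    V.disc hT μ (fun x _ => x) = μ.1 := by
  apply Subtype.ext
  change discV T N (V.toFun μ.1 : Measure (E d × E d)) (fun x _ => x) = (μ.1 : Measure (E d))
  set W := (V.toFun μ.1 : Measure (E d × E d)) with hW
  let A : (Fin d → ℤ) × (Fin d → ℤ) → Set (E d × E d) := fun ij =>
    {latticePoint (xStep T N) ij.1} ×ˢ cell (vStep N) (latticePoint (vStep N) ij.2)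
  have hA : ∀ ij, MeasurableSet (A ij) := fun ij =>
    (measurableSet_singleton _).prod (measurableSet_cell _ _)
  have hdisj : Pairwise (Function.onFun Disjoint A) := by
    rintro ⟨i, j⟩ ⟨i', j'⟩ hne
    rw [Function.onFun, Set.disjoint_left]
    rintro ⟨x, v⟩ ⟨h1, h2⟩ ⟨h3, h4⟩
    obtain rfl : i = i' := latticePoint_injective (xStep_pos hT N) (h1.symm.trans h3)
    obtain rfl : j = j' := by
      by_contra hj
      exact Set.disjoint_left.1 (disjoint_cell (vStep_pos N) hj) h2 h4
    exact hne rfl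
  have hfull : ∀ᵐ p ∂W, p ∈ ⋃ ij, A ij := by
    have h := V.fst_compl_lattice μ
    rw [Measure.map_apply measurable_fst (measurableSet_range_latticePoint _).compl] at h
    have h' : ∀ᵐ p ∂W, p.1 ∈ Set.range (latticePoint (xStep T N) : (Fin d → ℤ) → E d) := h
    filter_upwards [h'] with p ⟨i, hi⟩
    have hv : p.2 ∈ ⋃ j : Fin d → ℤ, cell (vStep N) (latticePoint (vStep N) j) := by
      rw [iUnion_cell (vStep_pos N)]; trivial
    obtain ⟨j, hj⟩ := Set.mem_iUnion.1 hv
    exact Set.mem_iUnion.2 ⟨(i, j), hi.symm, hj⟩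
  have hsum : W = Measure.sum fun ij => W.restrict (A ij) := by
    rw [← Measure.restrict_iUnion hdisj hA, Measure.restrict_eq_self_of_ae_mem hfull]
  rw [← V.fst_eq μ.1, ← hW]
  conv_rhs => rw [hsum]
  rw [Measure.map_sum measurable_fst.aemeasurable, discV]
  congr 1
  funext ij
  have hc : Prod.fst =ᵐ[W.restrict (A ij)] fun _ => latticePoint (xStep T N) ij.1 := by
    filter_upwards [ae_restrict_mem (hA ij)] with p hp using hp.1
  rw [Measure.map_congr hc, Measure.map_const, Measure.restrict_apply_univ]
  rfl

lemma node_succ (T : ℝ) (N : ℕ+) (k : ℕ) : node T N (k + 1) = node T N k + tStep T N := by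
  simp only [node]; push_cast; ring

lemma las_node (V : PVF d) (μ₀ : ProbabilityMeasure (E d)) {T : ℝ} (hT : 0 < T) (N : ℕ+)
    (k : ℕ) : las V μ₀ hT N (node T N k) = (lasNode V μ₀ hT N k).1 := by
  have h : ⌊node T N k / tStep T N⌋₊ = k := by
    rw [node, mul_div_cancel_right₀ _ (tStep_pos hT N).ne', Nat.floor_natCast]
  rw [las, h]
  simp only [node, sub_self, zero_smul, add_zero]
  exact V.disc_fst hT _

/-- The formula for the LAS on the closed time interval `[kΔ_N, (k+1)Δ_N]`. -/
lemma las_of_mem_Icc (V : PVF d) (μ₀ : ProbabilityMeasure (E d)) {T : ℝ} (hT : 0 < T) (N : ℕ+)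
    {k : ℕ} {t : ℝ} (h1 : node T N k ≤ t) (h2 : t ≤ node T N (k + 1)) :
    las V μ₀ hT N t =
      V.disc hT (lasNode V μ₀ hT N k) (fun x v => x + (t - node T N k) • v) := by
  have hΔ := tStep_pos hT N
  rcases h2.lt_or_eq with h2 | rfl
  · have h : ⌊t / tStep T N⌋₊ = k := by
      have h0 : (0 : ℝ) ≤ t / tStep T N :=
        div_nonneg (le_trans (mul_nonneg k.cast_nonneg hΔ.le) h1) hΔ.le
      rw [Nat.floor_eq_iff h0, le_div_iff₀ hΔ, div_lt_iff₀ hΔ]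
      refine ⟨h1, ?_⟩
      simpa [node] using h2
    rw [las, h]
    rfl
  -- At the right endpoint the floor jumps to `k + 1`; the recursion defining that node is the
  -- formula with elapsed time `Δ_N`.
  · rw [las_node, node_succ, add_sub_cancel_left]
    rfl

/-! ### Evaluations of the measures on curves -/

lemma etaStep_map_ev (V : PVF d) (μ₀ : ProbabilityMeasure (E d)) {T : ℝ} (hT : 0 < T) (N : ℕ+)
    (l : ℕ) (t : Set.Icc (node T N l) (node T N (l + 1))) :
    (etaStep V μ₀ hT N l : Measure (Curves d (node T N l) (node T N (l + 1)))).map (ev t) =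
      las V μ₀ hT N t := by
  rw [etaStep, V.disc_map hT _ _ (continuous_ev t).measurable, las_of_mem_Icc V μ₀ hT N t.2.1 t.2.2]
  rfl

/-- The induction hypothesis at the last node supplies the marginal that the next gluing requires.
-/
lemma etaGlue_map_ev (V : PVF d) (μ₀ : ProbabilityMeasure (E d)) {T : ℝ} (hT : 0 < T) (N : ℕ+)
    (h : ℕ) (t : Set.Icc (node T N 0) (node T N (h + 1))) :
    (etaGlue V μ₀ hT N h : Measure (Curves d (node T N 0) (node T N (h + 1)))).map (ev t) =
      las V μ₀ hT N t := by
  induction h with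
  | zero => exact etaStep_map_ev V μ₀ hT N 0 t
  | succ h ih =>
    have e1 := ih ⟨node T N (h + 1), Set.right_mem_Icc.2 (node_mono hT N (Nat.zero_le _))⟩
    have e2 := etaStep_map_ev V μ₀ hT N (h + 1)
      ⟨node T N (h + 1), Set.left_mem_Icc.2 (node_mono hT N (Nat.le_succ _))⟩
    simp only [las_node] at e1 e2
    rcases le_total (t : ℝ) (node T N (h + 1)) with ht | ht
    · exact (glue_map_ev_left _ _ _ _ _ e1 e2 t ht).trans (ih ⟨t, t.2.1, ht⟩)
    · exact (glue_map_ev_right _ _ _ _ _ e1 e2 t ht).trans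
        (etaStep_map_ev V μ₀ hT N (h + 1) ⟨t, ht, t.2.2⟩)

lemma represents_eta (V : PVF d) (μ₀ : ProbabilityMeasure (E d)) {T : ℝ} (hT : 0 < T) (N : ℕ+) :
    Represents (eta V μ₀ hT N) fun t => las V μ₀ hT N t := by
  intro t
  rw [eta, ProbabilityMeasure.toMeasure_map,
    Measure.map_map (continuous_ev t).measurable (measurable_recast _ _)]
  exact etaGlue_map_ev V μ₀ hT N N.natPred
    ⟨t, (node_zero T N).trans_le t.2.1, t.2.2.trans_eq (node_last T N).symm⟩

/-! ### A priori bounds -/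

lemma norm_sub_le_of_mem_cell {s : ℝ} (hs : 0 ≤ s) {p y : E d} (h : y ∈ cell s p) :
    ‖y - p‖ ≤ √d * s := by
  rw [EuclideanSpace.norm_eq, ← Real.sqrt_sq hs, ← Real.sqrt_mul d.cast_nonneg]
  refine Real.sqrt_le_sqrt ?_
  calc ∑ a, ‖(y - p) a‖ ^ 2 ≤ ∑ _a : Fin d, s ^ 2 := by
        refine Finset.sum_le_sum fun a _ => ?_
        rw [Real.norm_eq_abs, sq_abs, PiLp.sub_apply]
        exact pow_le_pow_left₀ (h a).1 (h a).2.le 2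
    _ = d * s ^ 2 := by simp

lemma vStep_le_one (N : ℕ+) : vStep N ≤ 1 := by
  rw [vStep, div_le_one (by exact_mod_cast N.pos)]
  exact Nat.one_le_cast.2 N.pos

lemma tStep_le {T : ℝ} (hT : 0 < T) (N : ℕ+) : tStep T N ≤ T :=
  div_le_self hT.le (by exact Nat.one_le_cast.2 N.pos)

lemma xStep_le {T : ℝ} (hT : 0 < T) (N : ℕ+) : xStep T N ≤ T := by
  have := mul_le_mul (vStep_le_one N) (tStep_le hT N) (tStep_pos hT N).le zero_le_one
  rwa [one_mul] at this

lemma node_le {T : ℝ} (hT : 0 < T) (N : ℕ+) {k : ℕ} (hk : k ≤ N) : node T N k ≤ T := by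
  have h := node_last T N
  rw [PNat.natPred_add_one] at h
  exact (node_mono hT N hk).trans_eq h

/-- The bound of (H1) for grid measures carried by a ball, in terms of lattice points. -/
lemma norm_latticePoint_le_of_massV_ne_zero (V : PVF d) {C : ℝ}
    (hV : ∀ μ : ProbabilityMeasure (E d), HasCompactSupp μ →
      ∀ p ∈ (V.toFun μ : Measure (E d × E d)).support,
        ‖p.2‖ ≤ C * (1 + sSup ((fun x : E d => ‖x‖) '' (μ : Measure (E d)).support)))
    (hC : 0 ≤ C) {T : ℝ} {N : ℕ+} (μ : GridProb d T N) {ρ : ℝ} (hρ : 0 ≤ ρ)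
    (hμ : ∀ᵐ x ∂(μ.1 : Measure (E d)), x ∈ Metric.closedBall (0 : E d) ρ) {i j : Fin d → ℤ}
    (h : massV T N (V.toFun μ.1 : Measure (E d × E d)) i j ≠ 0) :
    ‖(latticePoint (xStep T N) i : E d)‖ ≤ ρ ∧
      ‖(latticePoint (vStep N) j : E d)‖ ≤ C * (1 + ρ) + √d := by
  have hsupp : (μ.1 : Measure (E d)).support ⊆ Metric.closedBall 0 ρ :=
    Measure.support_subset_of_isClosed Metric.isClosed_closedBall hμ
  have hcomp : HasCompactSupp μ.1 :=
    (isCompact_closedBall (0 : E d) ρ).of_isClosed_subset Measure.isClosed_support hsupp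
  have hsup : sSup ((fun x : E d => ‖x‖) '' (μ.1 : Measure (E d)).support) ≤ ρ := by
    refine Real.sSup_le ?_ hρ
    rintro _ ⟨x, hx, rfl⟩
    simpa using hsupp hx
  have hW : (V.toFun μ.1 : Measure (E d × E d)).support ⊆ Prod.fst ⁻¹' Metric.closedBall 0 ρ := by
    refine Measure.support_subset_of_isClosed
      (Metric.isClosed_closedBall.preimage continuous_fst) ?_
    rw [← V.fst_eq] at hμ
    exact ae_of_ae_map measurable_fst.aemeasurable hμ
  -- A set of positive mass meets the support, so (H1) applies to some `p` in it; `v_j` differs from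
  -- `p.2` by at most `√d / N ≤ √d`.
  obtain ⟨p, ⟨hp1, hp2⟩, hp⟩ := Measure.nonempty_inter_support_of_pos (pos_iff_ne_zero.2 h)
  have hp1 : p.1 = latticePoint (xStep T N) i := hp1
  refine ⟨by simpa [← hp1] using hW hp, ?_⟩
  have h1 := norm_sub_le_of_mem_cell (vStep_pos N).le hp2
  have h2 : √(d : ℝ) * vStep N ≤ √d :=
    mul_le_of_le_one_right (Real.sqrt_nonneg _) (vStep_le_one N)
  have h3 : ‖p.2‖ ≤ C * (1 + ρ) := (hV μ.1 hcomp p hp).trans (by gcongr)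
  have h4 := norm_sub_le p.2 (p.2 - latticePoint (vStep N) j)
  rw [sub_sub_cancel] at h4
  linarith

lemma discX_ae_mem_closedBall {T : ℝ} (hT : 0 < T) (N : ℕ+) (μ : Measure (E d)) {ρ : ℝ}
    (hμ : ∀ᵐ x ∂μ, x ∈ Metric.closedBall (0 : E d) ρ) :
    ∀ᵐ x ∂(discX T N μ), x ∈ Metric.closedBall (0 : E d) (ρ + √d * T) := by
  refine (Measure.ae_sum_iff' Metric.isClosed_closedBall.measurableSet).2 ?_
  intro i
  by_cases h0 : massX T N μ i = 0
  · simp only [h0, zero_smul, ae_zero]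
    exact eventually_bot
  · refine Measure.ae_smul_measure
      ((ae_dirac_iff Metric.isClosed_closedBall.measurableSet).2 ?_) _
    obtain ⟨y, hy, hyρ⟩ := (Measure.nonempty_inter_support_of_pos (pos_iff_ne_zero.2 h0))
    have hyρ : y ∈ Metric.closedBall (0 : E d) ρ :=
      Measure.support_subset_of_isClosed Metric.isClosed_closedBall hμ hyρ
    rw [mem_closedBall_zero_iff] at hyρ
    refine mem_closedBall_zero_iff.2 ?_
    have h1 := norm_sub_le_of_mem_cell (xStep_pos hT N).le hy
    have h2 : √(d : ℝ) * xStep T N ≤ √d * T :=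
      mul_le_mul_of_nonneg_left (xStep_le hT N) (Real.sqrt_nonneg _)
    have h4 := norm_sub_le y (y - latticePoint (xStep T N) i)
    rw [sub_sub_cancel] at h4
    linarith

/-- Discrete Gronwall bound for the supports of the LAS at the nodes. -/
lemma lasNode_ae_mem_closedBall (V : PVF d) {C : ℝ}
    (hV : ∀ μ : ProbabilityMeasure (E d), HasCompactSupp μ →
      ∀ p ∈ (V.toFun μ : Measure (E d × E d)).support,
        ‖p.2‖ ≤ C * (1 + sSup ((fun x : E d => ‖x‖) '' (μ : Measure (E d)).support)))
    (hC : 0 ≤ C) (μ₀ : ProbabilityMeasure (E d)) {ρ : ℝ} (hρ : 0 ≤ ρ)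
    (hμ₀ : ∀ᵐ x ∂(μ₀ : Measure (E d)), x ∈ Metric.closedBall (0 : E d) ρ)
    {T : ℝ} (hT : 0 < T) (N : ℕ+) (k : ℕ) :
    ∀ᵐ x ∂((lasNode V μ₀ hT N k).1 : Measure (E d)), x ∈ Metric.closedBall (0 : E d)
      ((1 + (ρ + √d * T)) * (1 + tStep T N * (C + √d)) ^ k - 1) := by
  have hd := Real.sqrt_nonneg (d : ℝ)
  have hΔ := (tStep_pos hT N).le
  have hB : 1 ≤ 1 + tStep T N * (C + √d) :=
    le_add_of_nonneg_right (mul_nonneg hΔ (add_nonneg hC hd))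
  induction k with
  | zero =>
    simp only [pow_zero, mul_one, add_sub_cancel_left]
    exact discX_ae_mem_closedBall hT N _ hμ₀
  | succ k ih =>
    refine V.disc_ae hT _ _ Metric.isClosed_closedBall.measurableSet fun i j hij => ?_
    -- `A` is one plus the radius at step `k`. One step leads to at most `A + Δ (C A + √d)`, and `A
    -- ≥ 1` absorbs `√d` into `√d A`.
    set A := (1 + (ρ + √d * T)) * (1 + tStep T N * (C + √d)) ^ k with hA
    have hA1 : 1 ≤ A :=
      one_le_mul_of_one_le_of_one_le (by nlinarith [mul_nonneg hd hT.le]) (one_le_pow₀ hB)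
    obtain ⟨hx, hv⟩ := norm_latticePoint_le_of_massV_ne_zero V hV hC _ (sub_nonneg.2 hA1) ih hij
    rw [add_sub_cancel] at hv
    rw [mem_closedBall_zero_iff, pow_succ, ← mul_assoc, ← hA]
    refine (norm_add_le _ _).trans ?_
    rw [norm_smul, Real.norm_of_nonneg hΔ]
    have h1 := mul_le_mul_of_nonneg_left hv hΔ
    have h2 : tStep T N * √d ≤ tStep T N * (√d * A) :=
      mul_le_mul_of_nonneg_left (le_mul_of_one_le_right hd hA1) hΔ
    nlinarith

/-- The lattice points that carry mass are bounded, uniformly in `N`. -/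
lemma exists_bound_latticePoint (V : PVF d) (hV : V.Sublinear) (μ₀ : ProbabilityMeasure (E d))
    (hμ₀ : HasCompactSupp μ₀) {T : ℝ} (hT : 0 < T) :
    ∃ R : ℝ, 0 ≤ R ∧ ∀ (N : ℕ+) (k : ℕ), k ≤ N → ∀ i j : Fin d → ℤ,
      massV T N (V.toFun (lasNode V μ₀ hT N k).1 : Measure (E d × E d)) i j ≠ 0 →
        ‖(latticePoint (xStep T N) i : E d)‖ ≤ R ∧ ‖(latticePoint (vStep N) j : E d)‖ ≤ R := by
  obtain ⟨C, hC, hV⟩ := hV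
  obtain ⟨ρ, hρ, hsupp⟩ := hμ₀.isBounded.subset_closedBall_lt 0 0
  have hae : ∀ᵐ x ∂(μ₀ : Measure (E d)), x ∈ Metric.closedBall (0 : E d) ρ :=
    mem_of_superset Measure.support_mem_ae hsupp
  have hd := Real.sqrt_nonneg (d : ℝ)
  have hB : 0 ≤ C + √d := add_nonneg hC.le hd
  set A := (1 + (ρ + √d * T)) * Real.exp (T * (C + √d)) with hA
  have hA0 : 0 ≤ A := by positivity
  -- Positions are bounded by `A - 1` and velocities by `C A + √d`; the sum bounds both.
  refine ⟨A + (C * A + √d), by positivity, fun N k hk i j hij => ?_⟩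
  have hΔ := (tStep_pos hT N).le
  have hA1 : 1 ≤ A :=
    one_le_mul_of_one_le_of_one_le (by nlinarith [mul_nonneg hd hT.le])
      (Real.one_le_exp (mul_nonneg hT.le hB))
  have hpow : (1 + tStep T N * (C + √d)) ^ k ≤ Real.exp (T * (C + √d)) := by
    calc (1 + tStep T N * (C + √d)) ^ k ≤ Real.exp (tStep T N * (C + √d)) ^ k := by
          gcongr
          rw [add_comm]
          exact Real.add_one_le_exp _
      _ = Real.exp (node T N k * (C + √d)) := by rw [← Real.exp_nat_mul, node]; ring_nf
      _ ≤ Real.exp (T * (C + √d)) := by gcongr; exact node_le hT N hk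
  have hball := lasNode_ae_mem_closedBall V hV hC.le μ₀ hρ.le hae hT N k
  have hball' : ∀ᵐ x ∂((lasNode V μ₀ hT N k).1 : Measure (E d)),
      x ∈ Metric.closedBall (0 : E d) (A - 1) := by
    filter_upwards [hball] with x hx
    refine Metric.closedBall_subset_closedBall (sub_le_sub_right ?_ 1) hx
    exact mul_le_mul_of_nonneg_left hpow (by positivity)
  obtain ⟨hx, hv⟩ :=
    norm_latticePoint_le_of_massV_ne_zero V hV hC.le _ (sub_nonneg.2 hA1) hball' hij
  rw [add_sub_cancel] at hv
  have := mul_nonneg hC.le hA0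
  constructor <;> linarith

/-! ### The measures on curves are carried by a compact set -/

/-- The curve starts within `R` of the origin and moves at speed at most `R` for a time at most `T`.
-/
lemma charCurve_mem_lipCurves {a b R T : ℝ} (hR : 0 ≤ R) (hab : b - a ≤ T) {x v : E d}
    (hx : ‖x‖ ≤ R) (hv : ‖v‖ ≤ R) :
    charCurve a b x v ∈ lipCurves d a b (R + T * R) R.toNNReal := by
  constructor
  · intro t
    have h0 : 0 ≤ (t : ℝ) - a := sub_nonneg.2 t.2.1
    have h1 : (t : ℝ) - a ≤ T := (sub_le_sub_right t.2.2 a).trans hab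
    change ‖x + ((t : ℝ) - a) • v‖ ≤ _
    refine (norm_add_le _ _).trans (add_le_add hx ?_)
    rw [norm_smul, Real.norm_of_nonneg h0]
    exact mul_le_mul h1 hv (norm_nonneg _) (h0.trans h1)
  · refine LipschitzWith.of_dist_le_mul fun s t => ?_
    change dist (x + ((s : ℝ) - a) • v) (x + ((t : ℝ) - a) • v) ≤ _
    rw [dist_add_left, dist_eq_norm, ← sub_smul, sub_sub_sub_cancel_right, norm_smul,
      Real.coe_toNNReal _ hR, Subtype.dist_eq, Real.dist_eq, Real.norm_eq_abs, mul_comm]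
    exact mul_le_mul_of_nonneg_right hv (abs_nonneg _)

lemma etaStep_ae_mem_lipCurves (V : PVF d) (μ₀ : ProbabilityMeasure (E d)) {T : ℝ} (hT : 0 < T)
    {R : ℝ} (hR : 0 ≤ R) {N : ℕ+} {l : ℕ}
    (h : ∀ i j : Fin d → ℤ,
      massV T N (V.toFun (lasNode V μ₀ hT N l).1 : Measure (E d × E d)) i j ≠ 0 →
        ‖(latticePoint (xStep T N) i : E d)‖ ≤ R ∧ ‖(latticePoint (vStep N) j : E d)‖ ≤ R) :
    ∀ᵐ γ ∂(etaStep V μ₀ hT N l : Measure (Curves d (node T N l) (node T N (l + 1)))),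
      γ ∈ lipCurves d (node T N l) (node T N (l + 1)) (R + T * R) R.toNNReal := by
  refine V.disc_ae hT _ _ (measurableSet_lipCurves _ _ _ _) fun i j hij => ?_
  refine charCurve_mem_lipCurves hR ?_ (h i j hij).1 (h i j hij).2
  rw [node_succ, add_sub_cancel_left]
  exact tStep_le hT N

lemma etaGlue_ae_mem_lipCurves (V : PVF d) (μ₀ : ProbabilityMeasure (E d)) {T : ℝ} (hT : 0 < T)
    {R : ℝ} (hR : 0 ≤ R) {N : ℕ+}
    (hbd : ∀ k : ℕ, k ≤ N → ∀ i j : Fin d → ℤ,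
      massV T N (V.toFun (lasNode V μ₀ hT N k).1 : Measure (E d × E d)) i j ≠ 0 →
        ‖(latticePoint (xStep T N) i : E d)‖ ≤ R ∧ ‖(latticePoint (vStep N) j : E d)‖ ≤ R)
    (h : ℕ) (hh : h ≤ N) :
    ∀ᵐ γ ∂(etaGlue V μ₀ hT N h : Measure (Curves d (node T N 0) (node T N (h + 1)))),
      γ ∈ lipCurves d (node T N 0) (node T N (h + 1)) (R + T * R) R.toNNReal := by
  induction h with
  | zero => exact etaStep_ae_mem_lipCurves V μ₀ hT hR (hbd 0 hh)
  | succ h ih =>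
    have e1 := etaGlue_map_ev V μ₀ hT N h
      ⟨node T N (h + 1), Set.right_mem_Icc.2 (node_mono hT N (Nat.zero_le _))⟩
    have e2 := etaStep_map_ev V μ₀ hT N (h + 1)
      ⟨node T N (h + 1), Set.left_mem_Icc.2 (node_mono hT N (Nat.le_succ _))⟩
    simp only [las_node] at e1 e2
    exact glue_ae_mem_lipCurves _ _ _ _ _ e1 e2 (ih (Nat.le_of_succ_le hh))
      (etaStep_ae_mem_lipCurves V μ₀ hT hR (hbd (h + 1) hh))

lemma recast_mem_lipCurves {a b a' b' r : ℝ} {L : ℝ≥0} (ha : a = a') (hb : b = b')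
    {γ : Curves d a b} (h : γ ∈ lipCurves d a b r L) :
    recast ha hb γ ∈ lipCurves d a' b' r L := by
  subst ha hb
  exact h

/-- The measures `η^N` are carried by a common compact set of curves. -/
lemma exists_isCompact_eta_compl_eq_zero (V : PVF d) (hV : V.Sublinear)
    (μ₀ : ProbabilityMeasure (E d)) (hμ₀ : HasCompactSupp μ₀) {T : ℝ} (hT : 0 < T) :
    ∃ K : Set (Curves d 0 T), IsCompact K ∧
      ∀ N : ℕ+, (eta V μ₀ hT N : Measure (Curves d 0 T)) Kᶜ = 0 := by
  obtain ⟨R, hR, hbd⟩ := exists_bound_latticePoint V hV μ₀ hμ₀ hT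
  refine ⟨lipCurves d 0 T (R + T * R) R.toNNReal, isCompact_lipCurves _ _ _ _, fun N => ?_⟩
  change ∀ᵐ γ ∂(eta V μ₀ hT N : Measure (Curves d 0 T)),
    γ ∈ lipCurves d 0 T (R + T * R) R.toNNReal
  rw [eta, ProbabilityMeasure.toMeasure_map]
  refine (ae_map_iff (measurable_recast _ _).aemeasurable
    (measurableSet_lipCurves 0 T (R + T * R) R.toNNReal)).2 ?_
  filter_upwards [etaGlue_ae_mem_lipCurves V μ₀ hT hR (hbd N) N.natPred
    (by rw [← PNat.natPred_add_one N]; exact Nat.le_succ _)] with γ hγ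
  exact recast_mem_lipCurves _ _ hγ

/-! ### Wasserstein convergence implies weak convergence -/

/-- The easy half of Kantorovich–Rubinstein duality: under any coupling the difference is the
integral of `f z.1 - f z.2`, which the Lipschitz bound controls by the transport cost. -/
lemma enorm_integral_sub_le_W1 {X : Type*} [PseudoEMetricSpace X] [SecondCountableTopology X]
    [MeasurableSpace X] [OpensMeasurableSpace X]
    (μ ν : ProbabilityMeasure X) {f : X → ℝ} (hb : ∃ C, ∀ x y, dist (f x) (f y) ≤ C)
    {L : ℝ≥0} (hL : L ≠ 0) (hf : LipschitzWith L f) :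
    ‖∫ x, f x ∂(μ : Measure X) - ∫ x, f x ∂(ν : Measure X)‖ₑ ≤ L * W1 μ ν := by
  obtain ⟨C, hC⟩ := hb
  have hint : ∀ ρ : ProbabilityMeasure X, Integrable f (ρ : Measure X) := fun ρ =>
    (BoundedContinuousFunction.mkOfBound ⟨f, hf.continuous⟩ C hC).integrable (ρ : Measure X)
  rw [W1, ENNReal.mul_iInf_of_ne (by simpa using hL) ENNReal.coe_ne_top]
  refine le_iInf ?_
  rintro ⟨π, h1, h2⟩
  have e1 : ∫ x, f x ∂(μ : Measure X) = ∫ z, f z.1 ∂π := by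
    rw [← h1, integral_map measurable_fst.aemeasurable
      hf.continuous.measurable.aestronglyMeasurable]
  have e2 : ∫ x, f x ∂(ν : Measure X) = ∫ z, f z.2 ∂π := by
    rw [← h2, integral_map measurable_snd.aemeasurable
      hf.continuous.measurable.aestronglyMeasurable]
  have i1 : Integrable (fun z : X × X => f z.1) π :=
    (h1 ▸ hint μ : Integrable f (π.map Prod.fst)).comp_measurable measurable_fst
  have i2 : Integrable (fun z : X × X => f z.2) π :=
    (h2 ▸ hint ν : Integrable f (π.map Prod.snd)).comp_measurable measurable_snd
  rw [e1, e2, ← integral_sub i1 i2, ← lintegral_const_mul' _ _ ENNReal.coe_ne_top]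
  refine (enorm_integral_le_lintegral_enorm _).trans (lintegral_mono fun z => ?_)
  rw [← edist_eq_enorm_sub]
  exact hf z.1 z.2

lemma tendsto_of_tendsto_W1 {ι X : Type*} [PseudoEMetricSpace X] [SecondCountableTopology X]
    [MeasurableSpace X] [OpensMeasurableSpace X] {l : Filter ι} [l.IsCountablyGenerated]
    {μs : ι → ProbabilityMeasure X} {μ : ProbabilityMeasure X}
    (h : Tendsto (fun i => W1 (μs i) μ) l (𝓝 0)) : Tendsto μs l (𝓝 μ) := by
  rw [tendsto_iff_forall_lipschitz_integral_tendsto]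
  rintro f hb ⟨L, hL⟩
  -- A nonzero Lipschitz constant is needed to move it inside the infimum defining `W1`.
  have hL' : LipschitzWith (L + 1) f := hL.weaken le_self_add
  rw [tendsto_iff_edist_tendsto_0]
  refine tendsto_of_tendsto_of_tendsto_of_le_of_le tendsto_const_nhds
    (h := fun i => ((L + 1 : ℝ≥0) : ℝ≥0∞) * W1 (μs i) μ) ?_ (fun _ => zero_le) fun i => ?_
  · have := ENNReal.Tendsto.const_mul (a := ((L + 1 : ℝ≥0) : ℝ≥0∞)) h
      (Or.inr ENNReal.coe_ne_top)
    rwa [mul_zero] at this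
  · rw [edist_eq_enorm_sub]
    exact enorm_integral_sub_le_W1 _ _ hb (by positivity) hL'

/-- Representations pass to the limit. -/
lemma represents_of_tendsto {T : ℝ} {ηs : ℕ → ProbabilityMeasure (Curves d 0 T)}
    {η : ProbabilityMeasure (Curves d 0 T)} {μs : ℕ → Set.Icc 0 T → ProbabilityMeasure (E d)}
    {μ : Set.Icc 0 T → ProbabilityMeasure (E d)} (hη : Tendsto ηs atTop (𝓝 η))
    (hrep : ∀ n, Represents (ηs n) (μs n))
    (hμ : ∀ t, Tendsto (fun n => W1 (μs n t) (μ t)) atTop (𝓝 0)) : Represents η μ := by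
  intro t
  -- The marginals at `t` converge weakly both to `e_t♯η` and, through `W1`, to `μ_t`; weak limits
  -- are unique.
  have h1 := ((ProbabilityMeasure.continuous_map (continuous_ev (d := d) t)).tendsto η).comp hη
  have h2 : (fun ν : ProbabilityMeasure (Curves d 0 T) =>
      ν.map (continuous_ev t).measurable.aemeasurable) ∘ ηs = fun n => μs n t :=
    funext fun n => Subtype.ext (hrep n t)
  rw [h2] at h1
  have h3 := tendsto_nhds_unique h1 (tendsto_of_tendsto_W1 (hμ t))
  exact congrArg Subtype.val h3

/-- Probability measures carried by a common compact set have a weakly converging subsequence. -/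
lemma exists_subseq_tendsto_of_compl_eq_zero {X : Type*} [TopologicalSpace X]
    [TopologicalSpace.MetrizableSpace X] [TopologicalSpace.SeparableSpace X] [MeasurableSpace X]
    [BorelSpace X] {K : Set X} (hK : IsCompact K) {ηs : ℕ → ProbabilityMeasure X}
    (h : ∀ n, (ηs n : Measure X) Kᶜ = 0) :
    ∃ (η : ProbabilityMeasure X) (ψ : ℕ → ℕ), StrictMono ψ ∧
      Tendsto (fun n => ηs (ψ n)) atTop (𝓝 η) := by
  -- Prokhorov's theorem, with the constant compact set `K` and the constant bound zero on the mass
  -- outside it.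
  have hc := isCompact_setOfPred_probabilityMeasure_mass_eq_compl_isCompact_le (E := X)
    (u := fun _ => 0) (K := fun _ => K) tendsto_const_nhds (fun _ => hK) (Or.inr monotone_const)
  obtain ⟨η, -, ψ, hψ, hlim⟩ := hc.tendsto_subseq (x := ηs) fun n _ => by
    simp [ProbabilityMeasure.coeFn_def, h n]
  exact ⟨η, ψ, hψ, hlim⟩

end MDE

theorem proposition3p6 {d : ℕ} (V : MDE.PVF d) (hH1 : V.Sublinear) (hH2 : V.ContinuousOnCompact)
    (μ₀ : ProbabilityMeasure (MDE.E d)) (hμ₀ : MDE.HasCompactSupp μ₀) {T : ℝ} (hT : 0 < T) :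
    -- the lattice points that carry mass are bounded, uniformly in `N`
    (∃ R : ℝ, ∀ (N : ℕ+) (k : ℕ), k ≤ N → ∀ i j : Fin d → ℤ,
      MDE.massV T N (V.toFun (MDE.lasNode V μ₀ hT N k).1 : Measure (MDE.E d × MDE.E d)) i j ≠ 0 →
        ‖MDE.latticePoint (d := d) (MDE.xStep T N) i‖ ≤ R ∧
          ‖MDE.latticePoint (d := d) (MDE.vStep N) j‖ ≤ R) ∧
    -- `η^N` represents the LAS
    (∀ N : ℕ+, MDE.Represents (MDE.eta V μ₀ hT N) fun t => MDE.las V μ₀ hT N t) ∧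
    -- if the LASs converge along a sequence, uniformly in time, a subsequence of `η^N` converges
    -- weakly to a representation of the limit
    (∀ (φ : ℕ → ℕ+) (μ : Set.Icc 0 T → ProbabilityMeasure (MDE.E d)), StrictMono φ →
      Tendsto (fun n => ⨆ t : Set.Icc 0 T, MDE.W1 (MDE.las V μ₀ hT (φ n) t) (μ t)) atTop (𝓝 0) →
      ∃ (ψ : ℕ → ℕ) (η : ProbabilityMeasure (MDE.Curves d 0 T)), StrictMono ψ ∧
        Tendsto (fun n => MDE.eta V μ₀ hT (φ (ψ n))) atTop (𝓝 η) ∧ MDE.Represents η μ) := by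
  refine ⟨?_, MDE.represents_eta V μ₀ hT, fun φ μ _ hφ => ?_⟩
  · obtain ⟨R, -, hR⟩ := MDE.exists_bound_latticePoint V hH1 μ₀ hμ₀ hT
    exact ⟨R, hR⟩
  · obtain ⟨K, hK, hη⟩ := MDE.exists_isCompact_eta_compl_eq_zero V hH1 μ₀ hμ₀ hT
    obtain ⟨η, ψ, hψ, hlim⟩ := MDE.exists_subseq_tendsto_of_compl_eq_zero hK fun n => hη (φ n)
    refine ⟨ψ, η, hψ, hlim, MDE.represents_of_tendsto hlim
      (fun n => MDE.represents_eta V μ₀ hT (φ (ψ n))) fun t => ?_⟩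
    exact tendsto_of_tendsto_of_tendsto_of_le_of_le tendsto_const_nhds
      (hφ.comp hψ.tendsto_atTop) (fun _ => zero_le)
      fun n => le_iSup (fun t : Set.Icc 0 T => MDE.W1 (MDE.las V μ₀ hT (φ (ψ n)) t) (μ t)) t
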